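/- A $3$-graph $H$ consists of a finite vertex set $V(H)$ and a set $E(H)$ of $3$-element subsets of $V(H)$, called edges. Its minimum codegree $\delta(H)$ is the minimum, over all pairs $f$ of distinct vertices of $H$, of the number of edges of $H$ containing $f$. For $S \subseteq V(H)$ let $H[S]$ be the $3$-graph with vertex set $S$ whose edges are all edges of $H$ contained in $S$; the density of a $3$-graph on $m$ vertices with $q$ edges is $q/\binom{m}{3}$. For $\gamma>0$, a $3$-graph $H$ on $n$ vertices is $\gamma$-extremal if there is a set $S \subseteq V(H)$ with $|S| = \lfloor 3n/5 \rfloor$ such that $H[S]$ has density at most $\gamma$. Let $T$ (the generalised triangle) be the $3$-graph with five vertices $a,b,c,d,e$ and three edges $abc$, $abd$, $cde$. A perfect $T$-tiling in $H$ is a set of pairwise vertex-disjoint copies of $T$ in $H$ (subgraphs of $H$, not necessarily induced, isomorphic to $T$) such that every vertex of $H$ lies in one of these copies. **Lemma.** There exist $\gamma > 0$ and $n_0 \in \mathbb{N}$ for which the following holds. Let $H$ be a $3$-graph on $n \ge n_0$ vertices with $\delta(H) \ge 2n/5$ and $5 \mid n$. If $H$ is $\gamma$-extremal, then $H$ contains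 a perfect $T$-tiling. -/

import Mathlib

namespace Hypergraph

/-- `H` is `k`-uniform (a `k`-graph): every edge consists of exactly `k` distinct vertices. -/
def IsUniform {α : Type*} (H : Hypergraph α) (k : ℕ) : Prop :=
  ∀ e ∈ H.edgeSet, e.ncard = k

/-- The degree of a set `f` of vertices: the number of edges containing `f`. -/
noncomputable def degree {α : Type*} (H : Hypergraph α) (f : Set α) : ℕ :=
  {e | e ∈ H.edgeSet ∧ f ⊆ e}.ncard

/-- The minimum codegree of a finite `k`-graph `H`: the minimum of `deg(f)` over all sets `f` of
`k - 1` vertices of `H`. -/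
noncomputable def minCodegree {α : Type*} (H : Hypergraph α) (k : ℕ) : ℕ :=
  sInf {d | ∃ f : Set α, f ⊆ H.vertexSet ∧ f.ncard + 1 = k ∧ H.degree f = d}

/-- The density `e(H) / (n choose k)` of a `k`-graph `H` on `n` vertices. -/
noncomputable def density {α : Type*} (H : Hypergraph α) (k : ℕ) : ℝ :=
  (H.edgeSet.ncard : ℝ) / (H.vertexSet.ncard.choose k : ℝ)

/-- The subgraph `H[S]` induced by a set `S` of vertices of `H`. -/
def induce {α : Type*} (H : Hypergraph α) (S : Set α) : Hypergraph α where
  vertexSet := S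
  edgeSet := {e | e ∈ H.edgeSet ∧ e ⊆ S}
  subset_vertexSet_of_mem_edgeSet' := fun _ he => he.2

/-- A `3`-graph `H` on `n` vertices is `γ`-extremal if some set `S` of `⌊3n/5⌋` vertices induces
a subgraph of density at most `γ`. -/
def IsExtremal {α : Type*} (H : Hypergraph α) (γ : ℝ) : Prop :=
  ∃ S : Set α, S ⊆ H.vertexSet ∧ S.ncard = 3 * H.vertexSet.ncard / 5 ∧
    (H.induce S).density 3 ≤ γ

/-- `K` is a copy of `F` in `H`: a (not necessarily induced) subgraph of `H` isomorphic to `F`. -/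
def IsCopyIn {α β : Type*} (F : Hypergraph β) (H K : Hypergraph α) : Prop :=
  (K.vertexSet ⊆ H.vertexSet ∧ K.edgeSet ⊆ H.edgeSet) ∧
    ∃ φ : β → α, Set.InjOn φ F.vertexSet ∧ F.image φ = K

/-- An `F`-tiling in `H`: a set of pairwise vertex-disjoint copies of `F` in `H`. -/
def IsTiling {α β : Type*} (F : Hypergraph β) (H : Hypergraph α) (𝓕 : Set (Hypergraph α)) :
    Prop :=
  (∀ K ∈ 𝓕, IsCopyIn F H K) ∧
    𝓕.Pairwise fun K L => Disjoint K.vertexSet L.vertexSet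

/-- A perfect `F`-tiling in `H`: an `F`-tiling in which every vertex of `H` is covered. -/
def IsPerfectTiling {α β : Type*} (F : Hypergraph β) (H : Hypergraph α)
    (𝓕 : Set (Hypergraph α)) : Prop :=
  IsTiling F H 𝓕 ∧ ∀ v ∈ H.vertexSet, ∃ K ∈ 𝓕, v ∈ K.vertexSet

/-- The generalised triangle `T`: vertices `a, b, c, d, e = 0, 1, 2, 3, 4` and
edges `abc`, `abd`, `cde`. -/
def generalisedTriangle : Hypergraph (Fin 5) where
  vertexSet := Set.univ
  edgeSet := {{0, 1, 2}, {0, 1, 3}, {2, 3, 4}}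
  subset_vertexSet_of_mem_edgeSet' := fun e _ => Set.subset_univ e

end Hypergraph

/-! Write n = 5m, let B₀ be the sparse set of 3m vertices and A₀ its complement, of size 2m. A pair
inside B₀ has codegree at least 2m = |A₀|, so each triple of type A₀B₀B₀ that is missing is paid for
by an edge inside B₀ (`sum_missCard_compl_le`). Hence almost all triples with one vertex in A₀ and
two in B₀ are edges, and copies of T with two vertices in A₀ and three in B₀ abound.

`tileable_univ_of_sparse` moves a few vertices to get parts A and B in which every vertex of B has a
small link inside B, and every vertex of A has either an almost complete link in B or, for a small
set Z, at least a link of positive density there. This is `NearExtremal`.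

A few tiles are then removed greedily. Tiles of type 1+4 or 3+2 restore the ratio 2:3 exactly
(`exists_tileable_balanced`); they exist because of the codegree condition. Next, tiles of type 2+3
absorb Z (`exists_tileable_exceptional`).

What remains is split into two classes in A and three in B, all of one size k, and is tiled by
transversals whose three edges are of type ABB. Such a matching comes from a switching argument
(`exists_perm_forall_of_rotations`): as few triples through any vertex fail, a union bound finds
five rows that can be re-paired cyclically to repair a bad row. -/

open Finset

/-! ### Perfect matchings of five classes by switching -/

/-- Rotation lemma: if every index can be completed to five distinct indices all of whose rotations
satisfy `R`, then the five classes can be permuted so that `R` holds at every index. -/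
theorem exists_perm_forall_of_rotations {k : ℕ} (R : (Fin 5 → Fin k) → Prop)
    (h : ∀ (π : Fin 5 → Equiv.Perm (Fin k)) (i₀ : Fin k), ∃ g : Fin 5 → Fin k,
      Function.Injective g ∧ g 0 = i₀ ∧ ∀ p, R fun j => π j (g (p + j))) :
    ∃ π : Fin 5 → Equiv.Perm (Fin k), ∀ i, R fun j => π j i := by
  classical
  let good : (Fin 5 → Equiv.Perm (Fin k)) → Finset (Fin k) :=
    fun π => {i | R fun j => π j i}
  obtain ⟨π, -, hπ⟩ := exists_max_image univ (fun π => #(good π)) univ_nonempty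
  refine ⟨π, ?_⟩
  by_contra! hbad
  obtain ⟨i₀, hi₀⟩ := hbad
  obtain ⟨g, hg, hg0, hR⟩ := h π i₀
  let ι : Fin 5 ↪ Fin k := ⟨g, hg⟩
  -- Among the five rows listed by `g`, class `j` is shifted cyclically by `j`; all other rows are
  -- kept. The new row at `g p` is the rotation that `R` is known to accept.
  let π' : Fin 5 → Equiv.Perm (Fin k) :=
    fun j => ((Equiv.addRight j).viaEmbedding ι).trans (π j)
  have hin : ∀ p j, π' j (g p) = π j (g (p + j)) := by
    intro p j
    have := (Equiv.addRight j).viaEmbedding_apply ι p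
    simp only [π', Equiv.trans_apply]
    exact congrArg (π j) this
  have hout : ∀ i, i ∉ Set.range g → ∀ j, π' j i = π j i := by
    intro i hi j
    simp only [π', Equiv.trans_apply]
    exact congrArg (π j) ((Equiv.addRight j).viaEmbedding_apply_of_notMem ι i hi)
  -- Five rows become good, one of which was bad, and no other row changes, contradicting
  -- maximality.
  have hlt : good π ⊂ good π' := by
    refine ⟨fun i hi => ?_, fun hsub => ?_⟩
    · simp only [good, mem_filter, mem_univ, true_and] at hi ⊢
      by_cases hr : i ∈ Set.range g
      · obtain ⟨p, rfl⟩ := hr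
        simpa only [hin] using hR p
      · simpa only [hout i hr] using hi
    · have : i₀ ∈ good π' := by
        simp only [good, mem_filter, mem_univ, true_and]
        rw [← hg0]
        simpa only [hin] using hR 0
      have := hsub this
      simp only [good, mem_filter, mem_univ, true_and] at this
      exact hi₀ this
  exact absurd (hπ π' (mem_univ _)) (not_le.2 (card_lt_card hlt))

/-- The two remaining positions, labelled so that position 0, when unconstrained, is `q`. That entry
is prescribed, which is what the counting below exploits. -/
theorem exists_other_two : ∀ i j l : Fin 5, i ≠ j → i ≠ l → j ≠ l →
    ∃ p q : Fin 5, (i ≠ 0 → j ≠ 0 → l ≠ 0 → q = 0) ∧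
      ∀ x, x = i ∨ x = j ∨ x = l ∨ x = p ∨ x = q := by decide

/-- A triple constraint on indices whose violations are rare through every single index. -/
structure RarelyFails {k : ℕ} (D : ℕ) (P : Fin k → Fin k → Fin k → Prop) : Prop where
  fst : ∀ x, {p : Fin k × Fin k | ¬ P x p.1 p.2}.ncard ≤ D
  snd : ∀ y, {p : Fin k × Fin k | ¬ P p.1 y p.2}.ncard ≤ D
  trd : ∀ z, {p : Fin k × Fin k | ¬ P p.1 p.2 z}.ncard ≤ D

theorem RarelyFails.comp {k D : ℕ} {P : Fin k → Fin k → Fin k → Prop} (hP : RarelyFails D P)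
    (σ τ ρ : Equiv.Perm (Fin k)) : RarelyFails D fun x y z => P (σ x) (τ y) (ρ z) := by
  have key : ∀ (S : Set (Fin k × Fin k)) (u v : Equiv.Perm (Fin k)), S.ncard ≤ D →
      ((Equiv.prodCongr u v) ⁻¹' S).ncard ≤ D := by
    intro S u v hS
    rwa [Set.ncard_preimage_of_injective_subset_range (Equiv.injective _)]
    simp [(Equiv.surjective _).range_eq]
  exact ⟨fun x => key _ τ ρ (hP.fst (σ x)), fun y => key _ σ ρ (hP.snd (τ y)),
    fun z => key _ σ τ (hP.trd (ρ z))⟩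

/-- The number of `5`-tuples with a prescribed entry at `0` and violating a triple constraint. -/
theorem RarelyFails.card_le {k D : ℕ} {P : Fin k → Fin k → Fin k → Prop} (hP : RarelyFails D P)
    (i₀ : Fin k) {i j l : Fin 5} (hij : i ≠ j) (hil : i ≠ l) (hjl : j ≠ l) :
    {g : Fin 5 → Fin k | g 0 = i₀ ∧ ¬ P (g i) (g j) (g l)}.ncard ≤ D * k ^ 2 := by
  classical
  obtain ⟨p, q, hq, hall⟩ := exists_other_two i j l hij hil hjl
  have hcard : ∀ S : Set (Fin k × Fin k), S.ncard ≤ D →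
      (S ×ˢ (Set.univ : Set (Fin k × Fin k))).ncard ≤ D * k ^ 2 := by
    intro S hS
    rw [Set.ncard_prod, Set.ncard_univ, Nat.card_prod, Nat.card_fin, ← sq]
    exact Nat.mul_le_mul_right _ hS
  -- If position 0 is constrained, at most `D` pairs complete the violation, and the two other
  -- entries are free.
  by_cases hi : i = 0
  · refine (Set.ncard_le_ncard_of_injOn (fun g => ((g j, g l), (g p, g q))) ?_ ?_).trans
      (hcard _ (hP.fst i₀))
    · rintro g ⟨hg, hg'⟩
      refine ⟨?_, Set.mem_univ _⟩
      rw [hi, hg] at hg'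
      exact hg'
    · rintro f ⟨hf, -⟩ g ⟨hg, -⟩ hfg
      simp only [Prod.mk.injEq] at hfg
      funext x
      rcases hall x with rfl | rfl | rfl | rfl | rfl
      · rw [hi, hf, hg]
      all_goals tauto
  by_cases hj : j = 0
  · refine (Set.ncard_le_ncard_of_injOn (fun g => ((g i, g l), (g p, g q))) ?_ ?_).trans
      (hcard _ (hP.snd i₀))
    · rintro g ⟨hg, hg'⟩
      refine ⟨?_, Set.mem_univ _⟩
      rw [hj, hg] at hg'
      exact hg'
    · rintro f ⟨hf, -⟩ g ⟨hg, -⟩ hfg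
      simp only [Prod.mk.injEq] at hfg
      funext x
      rcases hall x with rfl | rfl | rfl | rfl | rfl
      · tauto
      · rw [hj, hf, hg]
      all_goals tauto
  by_cases hl : l = 0
  · refine (Set.ncard_le_ncard_of_injOn (fun g => ((g i, g j), (g p, g q))) ?_ ?_).trans
      (hcard _ (hP.trd i₀))
    · rintro g ⟨hg, hg'⟩
      refine ⟨?_, Set.mem_univ _⟩
      rw [hl, hg] at hg'
      exact hg'
    · rintro f ⟨hf, -⟩ g ⟨hg, -⟩ hfg
      simp only [Prod.mk.injEq] at hfg
      funext x
      rcases hall x with rfl | rfl | rfl | rfl | rfl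
      · tauto
      · tauto
      · rw [hl, hf, hg]
      all_goals tauto
  -- Position 0 is unconstrained: choose the entries at `i` and `p` freely, after which at most `D`
  -- pairs remain for `j` and `l`.
  have hq0 := hq hi hj hl
  subst hq0
  have hcard' : #((univ : Finset (Fin k × Fin k)).sigma
      fun u => {p : Fin k × Fin k | ¬ P u.1 p.1 p.2}.toFinset) ≤ D * k ^ 2 := by
    rw [card_sigma]
    refine (sum_le_card_nsmul _ _ D fun u _ => ?_).trans ?_
    · rw [← Set.ncard_eq_toFinset_card']
      exact hP.fst u.1
    · rw [card_univ, Fintype.card_prod, Fintype.card_fin, ← sq, smul_eq_mul, mul_comm]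
  rw [← Set.ncard_coe_finset] at hcard'
  refine (Set.ncard_le_ncard_of_injOn
    (fun g => (⟨(g i, g p), (g j, g l)⟩ : (_ : Fin k × Fin k) × (Fin k × Fin k))) ?_ ?_).trans
    hcard'
  · rintro g ⟨hg, hg'⟩
    simpa using hg'
  · rintro f ⟨hf, -⟩ g ⟨hg, -⟩ hfg
    simp only [Sigma.mk.injEq, Prod.mk.injEq, heq_eq_eq] at hfg
    funext x
    rcases hall x with rfl | rfl | rfl | rfl | rfl
    · tauto
    · tauto
    · tauto
    · tauto
    · rw [hf, hg]

/-- Distinctness is cast as a triple constraint with an idle third argument, so that collisions are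
counted by the same lemma as missing edges. -/
theorem rarelyFails_ne (k : ℕ) : RarelyFails (k := k) k fun x y _ => x ≠ y := by
  have key : ∀ (S : Set (Fin k × Fin k)) (f : Fin k × Fin k → Fin k), S.InjOn f → S.ncard ≤ k := by
    intro S f hf
    have := Set.ncard_le_ncard_of_injOn (t := Set.univ) f (fun _ _ => Set.mem_univ _) hf
    simpa [Set.ncard_univ] using this
  refine ⟨fun x => key _ Prod.snd ?_, fun x => key _ Prod.snd ?_, fun x => key _ Prod.fst ?_⟩
  all_goals
    rintro ⟨a, b⟩ h ⟨c, d⟩ h' hh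
    simp_all

/-- Three rarely failing constraints on five classes can be satisfied simultaneously by a perfect
matching of the classes. -/
theorem exists_perm_forall_of_rarelyFails {k D : ℕ} (P₁ P₂ P₃ : Fin k → Fin k → Fin k → Prop)
    (h₁ : RarelyFails D P₁) (h₂ : RarelyFails D P₂) (h₃ : RarelyFails D P₃)
    (hD : 15 * D + 20 * k < k ^ 2) :
    ∃ π : Fin 5 → Equiv.Perm (Fin k), ∀ i, P₁ (π 0 i) (π 1 i) (π 2 i) ∧
      P₂ (π 0 i) (π 1 i) (π 3 i) ∧ P₃ (π 4 i) (π 2 i) (π 3 i) := by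
  classical
  refine exists_perm_forall_of_rotations (fun f => P₁ (f 0) (f 1) (f 2) ∧
      P₂ (f 0) (f 1) (f 3) ∧ P₃ (f 4) (f 2) (f 3)) fun π i₀ => ?_
  let F₁ : Fin 5 → Set (Fin 5 → Fin k) := fun p => {g | g 0 = i₀ ∧
    ¬ P₁ (π 0 (g (p + 0))) (π 1 (g (p + 1))) (π 2 (g (p + 2)))}
  let F₂ : Fin 5 → Set (Fin 5 → Fin k) := fun p => {g | g 0 = i₀ ∧
    ¬ P₂ (π 0 (g (p + 0))) (π 1 (g (p + 1))) (π 3 (g (p + 3)))}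
  let F₃ : Fin 5 → Set (Fin 5 → Fin k) := fun p => {g | g 0 = i₀ ∧
    ¬ P₃ (π 4 (g (p + 4))) (π 2 (g (p + 2))) (π 3 (g (p + 3)))}
  let I : Fin 5 → Fin 4 → Set (Fin 5 → Fin k) := fun p s => {g | g 0 = i₀ ∧
    ¬ (g p ≠ g (p + s.succ))}
  have hne : ∀ p i j : Fin 5, i ≠ j → p + i ≠ p + j := fun p i j h h' => h (add_left_cancel h')
  have hF₁ : ∀ p, (F₁ p).ncard ≤ D * k ^ 2 := fun p =>
    (h₁.comp (π 0) (π 1) (π 2)).card_le i₀ (hne p _ _ (by decide)) (hne p _ _ (by decide))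
      (hne p _ _ (by decide))
  have hF₂ : ∀ p, (F₂ p).ncard ≤ D * k ^ 2 := fun p =>
    (h₂.comp (π 0) (π 1) (π 3)).card_le i₀ (hne p _ _ (by decide)) (hne p _ _ (by decide))
      (hne p _ _ (by decide))
  have hF₃ : ∀ p, (F₃ p).ncard ≤ D * k ^ 2 := fun p =>
    (h₃.comp (π 4) (π 2) (π 3)).card_le i₀ (hne p _ _ (by decide)) (hne p _ _ (by decide))
      (hne p _ _ (by decide))
  have hthird : ∀ (p : Fin 5) (s : Fin 4), ∃ l, p ≠ p + s.succ ∧ p ≠ l ∧ p + s.succ ≠ l := by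
    decide
  have hI : ∀ p s, (I p s).ncard ≤ k * k ^ 2 := by
    intro p s
    obtain ⟨l, h1, h2, h3⟩ := hthird p s
    exact (rarelyFails_ne k).card_le i₀ h1 h2 h3
  by_contra! hno
  have hcover : {g : Fin 5 → Fin k | g 0 = i₀} ⊆
      ⋃ p, (F₁ p ∪ F₂ p ∪ F₃ p ∪ ⋃ s, I p s) := by
    intro g hg
    by_contra hmem
    simp only [Set.mem_iUnion, Set.mem_union, not_exists, not_or] at hmem
    have hinj : Function.Injective g := by
      have hps : ∀ p q : Fin 5, p ≠ q → ∃ s : Fin 4, q = p + s.succ := by decide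
      intro p q hpq
      by_contra hne
      obtain ⟨s, rfl⟩ := hps p q hne
      exact (hmem p).2 s ⟨hg, not_not.2 hpq⟩
    obtain ⟨p, hp⟩ := hno g hinj hg
    obtain ⟨⟨⟨a1, a2⟩, a3⟩, -⟩ := hmem p
    refine hp ?_ ?_ ?_
    · by_contra hc; exact a1 ⟨hg, hc⟩
    · by_contra hc; exact a2 ⟨hg, hc⟩
    · by_contra hc; exact a3 ⟨hg, hc⟩
  -- Union bound over the five rotations, each with three edge constraints and four possible
  -- collisions. Against at least k⁴ tuples, this is where 15D + 20k < k² comes from.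
  have hupper : {g : Fin 5 → Fin k | g 0 = i₀}.ncard ≤ 5 * (3 * (D * k ^ 2) + 4 * (k * k ^ 2)) := by
    refine (Set.ncard_le_ncard hcover (Set.toFinite _)).trans ?_
    have hU : ∀ {ι : Type} [Fintype ι] (S : ι → Set (Fin 5 → Fin k)) (N : ℕ),
        (∀ i, (S i).ncard ≤ N) → (⋃ i, S i).ncard ≤ Fintype.card ι * N := by
      intro ι _ S N hS
      have h0 : (⋃ i, S i) = ↑(univ.biUnion fun i => (S i).toFinset) := by ext; simp
      rw [h0, Set.ncard_coe_finset]
      refine card_biUnion_le_card_mul _ _ _ fun i _ => ?_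
      rw [← Set.ncard_eq_toFinset_card']; exact hS i
    refine hU _ _ fun p => ?_
    have hIp := hU (I p) _ (hI p)
    have u1 := Set.ncard_union_le (F₁ p ∪ F₂ p ∪ F₃ p) (⋃ s, I p s)
    have u2 := Set.ncard_union_le (F₁ p ∪ F₂ p) (F₃ p)
    have u3 := Set.ncard_union_le (F₁ p) (F₂ p)
    have := hF₁ p
    have := hF₂ p
    have := hF₃ p
    simp only [Fintype.card_fin] at hIp
    omega
  have hlower : k ^ 4 ≤ {g : Fin 5 → Fin k | g 0 = i₀}.ncard := by
    have := Set.ncard_le_ncard_of_injOn (s := (Set.univ : Set (Fin 4 → Fin k)))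
      (t := {g : Fin 5 → Fin k | g 0 = i₀}) (fun f => Fin.cons i₀ f) (fun f _ => by simp)
      (fun f _ f' _ h => by simpa using h)
    simpa [Set.ncard_univ] using this
  have hk : 0 < k ^ 2 := by have := i₀.pos; positivity
  nlinarith

/-! ### Near-extremal partitions and the three kinds of special tile -/

section Tiles

open scoped Classical

variable {α : Type*}

/-- A relation recording the edges of a `3`-graph as ordered triples. -/
structure IsTripleSystem (E : α → α → α → Prop) : Prop where
  swap : ∀ {x y z}, E x y z → E y x z
  rot : ∀ {x y z}, E x y z → E x z y
  ne : ∀ {x y z}, E x y z → x ≠ y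

/-- `S` can be partitioned into generalised triangles of the triple system `E`. -/
inductive Tileable (E : α → α → α → Prop) : Finset α → Prop
  | empty : Tileable E ∅
  | add {S : Finset α} {a b c d e : α} : Tileable E S → [a, b, c, d, e].Nodup →
      (∀ x ∈ [a, b, c, d, e], x ∉ S) → E a b c → E a b d → E c d e →
      Tileable E (S ∪ {a, b, c, d, e})

/-- The number of pairs in `X × Y` forming an edge with `v`. -/
noncomputable def linkCard (E : α → α → α → Prop) (X Y : Finset α) (v : α) : ℕ :=
  #{p ∈ X ×ˢ Y | E v p.1 p.2}

/-- The number of pairs in `X × Y` not forming an edge with `v`. -/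
noncomputable def missCard (E : α → α → α → Prop) (X Y : Finset α) (v : α) : ℕ :=
  #{p ∈ X ×ˢ Y | ¬ E v p.1 p.2}

/-- `x` and `y` have at least `m` common neighbours in `A`. -/
def Rich (E : α → α → α → Prop) (A : Finset α) (m : ℕ) (x y : α) : Prop :=
  m ≤ #{c ∈ A | E x y c}

theorem card_filter_product_eq_sum {β γ : Type*} (X : Finset β) (Y : Finset γ)
    (P : β → γ → Prop) [∀ x y, Decidable (P x y)] :
    #{p ∈ X ×ˢ Y | P p.1 p.2} = ∑ x ∈ X, #{y ∈ Y | P x y} := by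
  simp only [card_filter, sum_product]

theorem card_filter_product_eq_sum_right {β γ : Type*} (X : Finset β) (Y : Finset γ)
    (P : β → γ → Prop) [∀ x y, Decidable (P x y)] :
    #{p ∈ X ×ˢ Y | P p.1 p.2} = ∑ y ∈ Y, #{x ∈ X | P x y} := by
  simp only [card_filter, sum_product_right]

theorem exists_pair_of_card_lt {X Y X' Y' : Finset α} {P : α → α → Prop} (hX : X' ⊆ X)
    (hY : Y' ⊆ Y) (h : #{p ∈ X ×ˢ Y | ¬ P p.1 p.2} < #X' * #Y') :
    ∃ x ∈ X', ∃ y ∈ Y', P x y := by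
  by_contra! hno
  refine absurd h (not_lt.2 ?_)
  rw [← card_product]
  refine card_le_card fun p hp => ?_
  rw [mem_product] at hp
  rw [mem_filter, mem_product]
  exact ⟨⟨hX hp.1, hY hp.2⟩, hno _ hp.1 _ hp.2⟩

theorem exists_pair_of_missCard_lt {E : α → α → α → Prop} {X Y X' Y' : Finset α} {v : α}
    (hX : X' ⊆ X) (hY : Y' ⊆ Y) (h : missCard E X Y v < #X' * #Y') :
    ∃ x ∈ X', ∃ y ∈ Y', E v x y :=
  exists_pair_of_card_lt hX hY h

theorem exists_pair_of_missCard_add_lt {E : α → α → α → Prop} {X Y X' Y' : Finset α} {v w : α}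
    (hX : X' ⊆ X) (hY : Y' ⊆ Y) (h : missCard E X Y v + missCard E X Y w < #X' * #Y') :
    ∃ x ∈ X', ∃ y ∈ Y', E v x y ∧ E w x y := by
  refine exists_pair_of_card_lt (P := fun x y => E v x y ∧ E w x y) hX hY
    (lt_of_le_of_lt ?_ h)
  refine (card_le_card ?_).trans (card_union_le _ _)
  intro p hp
  simp only [mem_filter, mem_union] at hp ⊢
  tauto

/-- Bookkeeping for adding one tile: the indicators reduce the effect on a part to the type of the
tile. -/
theorem card_union_five_inter {U X : Finset α} {a b c d e : α} (hn : [a, b, c, d, e].Nodup)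
    (hU : ∀ x ∈ [a, b, c, d, e], x ∉ U) :
    #((U ∪ {a, b, c, d, e}) ∩ X) = #(U ∩ X) + ((if a ∈ X then 1 else 0) +
      ((if b ∈ X then 1 else 0) + ((if c ∈ X then 1 else 0) + ((if d ∈ X then 1 else 0) +
      (if e ∈ X then 1 else 0))))) := by
  have hdisj : Disjoint U {a, b, c, d, e} := by
    rw [disjoint_right]
    intro x hx
    exact hU x (by simpa using hx)
  rw [union_inter_distrib_right, card_union_of_disjoint
    (hdisj.mono inter_subset_left inter_subset_left)]
  congr 1
  rw [← filter_mem_eq_inter, card_filter]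
  simp only [List.nodup_cons, List.mem_cons, List.not_mem_nil, or_false, not_or] at hn
  rw [sum_insert (by simp; tauto), sum_insert (by simp; tauto), sum_insert (by simp; tauto),
    sum_insert (by simp; tauto), sum_singleton]

variable [Fintype α]

/-- A triple system of large minimum codegree on `5 * m` vertices together with a partition into
`A` and `B`, of sizes about `2 * m` and `3 * m`, in which almost all triples with exactly one vertex
in `A` are edges; `Z` is the set of exceptional vertices of `A`. -/
structure NearExtremal (E : α → α → α → Prop) (m : ℕ) (A B Z : Finset α) : Prop where
  triple : IsTripleSystem E
  codegree : ∀ x y, x ≠ y → 2 * m ≤ #{z | E x y z}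
  compl : A = Bᶜ
  large : 1000000 ≤ m
  card_add : #A + #B = 5 * m
  card_le : 1000000 * #A ≤ 2000001 * m
  le_card : 1999999 * m ≤ 1000000 * #A
  sub : Z ⊆ A
  card_exceptional : 300000 * #Z ≤ m
  miss_typical : ∀ v ∈ A, v ∉ Z → 500 * missCard E B B v ≤ m ^ 2
  link_exceptional : ∀ v ∈ Z, m ^ 2 ≤ 2000 * linkCard E B B v
  link_B : ∀ v ∈ B, 500 * linkCard E B B v ≤ m ^ 2
  miss_B : ∀ v ∈ B, 1000 * missCard E A B v ≤ 3 * m ^ 2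

namespace NearExtremal

variable {E : α → α → α → Prop} {m : ℕ} {A B Z U : Finset α}

theorem notMem_B (h : NearExtremal E m A B Z) {x : α} (hx : x ∈ A) : x ∉ B := by
  rw [h.compl] at hx; simpa using hx

theorem notMem_A (h : NearExtremal E m A B Z) {x : α} (hx : x ∈ B) : x ∉ A := by
  rw [h.compl]; simpa using hx

theorem codegree_split (h : NearExtremal E m A B Z) {x y : α} (hxy : x ≠ y) :
    2 * m ≤ #{z ∈ A | E x y z} + #{z ∈ B | E x y z} := by
  refine (h.codegree x y hxy).trans ((card_le_card ?_).trans (card_union_le _ _))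
  intro z hz
  simp only [h.compl, mem_filter, mem_univ, true_and, mem_union, mem_compl] at hz ⊢
  tauto

/-- Most pairs in `B` have many common neighbours in `A`. -/
theorem card_sparse_pairs (h : NearExtremal E m A B Z) :
    9 * #{p ∈ B ×ˢ B | ¬ Rich E A m p.1 p.2} ≤ m ^ 2 := by
  have hm := h.large
  have h1 := h.le_card
  have h2 := h.card_add
  -- Double counting: each poor pair misses more than `#A - m`, roughly `m`, vertices of `A`, while
  -- `miss_B` bounds the total number of misses.
  have hlow : #{p ∈ B ×ˢ B | ¬ Rich E A m p.1 p.2} * (#A - m) ≤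
      ∑ p ∈ B ×ˢ B, #{c ∈ A | ¬ E p.1 p.2 c} := by
    refine le_trans (card_nsmul_le_sum _ (fun p => #{c ∈ A | ¬ E p.1 p.2 c}) _ fun p hp => ?_)
      (sum_le_sum_of_subset (filter_subset _ _))
    have hp2 := (mem_filter.1 hp).2
    rw [Rich, not_le] at hp2
    have := card_filter_add_card_filter_not (s := A) (fun c => E p.1 p.2 c)
    omega
  have hsum : ∑ p ∈ B ×ˢ B, #{c ∈ A | ¬ E p.1 p.2 c} = ∑ x ∈ B, missCard E A B x := by
    rw [sum_product]
    refine sum_congr rfl fun x _ => ?_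
    rw [missCard, card_filter_product_eq_sum_right A B fun c y => ¬ E x c y]
    refine sum_congr rfl fun y _ => ?_
    congr 1
    ext c
    simp only [mem_filter]
    exact and_congr_right fun _ => not_congr ⟨h.triple.rot, h.triple.rot⟩
  have hup : 1000 * ∑ x ∈ B, missCard E A B x ≤ #B * (3 * m ^ 2) := by
    rw [mul_sum, ← smul_eq_mul, ← sum_const]
    exact sum_le_sum fun x hx => h.miss_B x hx
  rw [hsum] at hlow
  set N := #{p ∈ B ×ˢ B | ¬ Rich E A m p.1 p.2}
  have hA : 9 * m ≤ 10 * (#A - m) := by omega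
  have hB : #B ≤ 4 * m := by omega
  have e1 : N * (9 * m) ≤ N * (10 * (#A - m)) := Nat.mul_le_mul_left _ hA
  have e2 : #B * (3 * m ^ 2) ≤ 4 * m * (3 * m ^ 2) := Nat.mul_le_mul_right _ hB
  have e3 : 1000 * (9 * N) * m ≤ 120 * m ^ 2 * m := by nlinarith
  have e4 := Nat.le_of_mul_le_mul_right e3 (by omega)
  omega

/-- If `B` is too large, there is a generalised triangle with four vertices in `B`. -/
theorem exists_tile_one_four (h : NearExtremal E m A B Z) {t : ℕ} (ht : 0 < t)
    (hB : #B = 3 * m + t) (hUA : #(U ∩ A) ≤ t) (hUB : #(U ∩ B) ≤ 4 * t) :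
    ∃ a b c d e, [a, b, c, d, e].Nodup ∧ (∀ x ∈ [a, b, c, d, e], x ∉ U) ∧ E a b c ∧ E a b d ∧
      E c d e ∧ a ∈ B ∧ b ∈ B ∧ c ∈ A ∧ d ∈ B ∧ e ∈ B := by
  have hm := h.large
  have h1 := h.le_card
  have h2 := h.card_add
  have hsp := h.card_sparse_pairs
  have hBU : #(B \ U) + #(U ∩ B) = #B := by rw [inter_comm]; exact card_sdiff_add_card_inter _ _
  set Q : Finset (α × α) := {p ∈ (B \ U) ×ˢ (B \ U) | Rich E A m p.1 p.2} with hQ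
  have hQcard : m ^ 2 ≤ #Q := by
    have e1 := card_filter_add_card_filter_not (s := (B \ U) ×ˢ (B \ U))
      (fun p => Rich E A m p.1 p.2)
    have e2 : #{p ∈ (B \ U) ×ˢ (B \ U) | ¬ Rich E A m p.1 p.2} ≤
        #{p ∈ B ×ˢ B | ¬ Rich E A m p.1 p.2} :=
      card_le_card (filter_subset_filter _ (product_subset_product sdiff_subset sdiff_subset))
    rw [card_product] at e1
    have e3 : (2 * m) * (2 * m) ≤ #(B \ U) * #(B \ U) :=
      Nat.mul_le_mul (by omega) (by omega)
    nlinarith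
  have hQne : ∀ p ∈ Q, p.1 ≠ p.2 := by
    intro p hp heq
    have hp2 : m ≤ #{c ∈ A | E p.1 p.2 c} := (mem_filter.1 hp).2
    have : #{c ∈ A | E p.1 p.2 c} = 0 := by
      rw [card_eq_zero, filter_eq_empty_iff]
      exact fun c _ hE => h.triple.ne hE heq
    omega
  -- As `#A = 2 * m - t`, each pair has at least `t` neighbours in `B`. Were these all in `U` for
  -- every rich pair, at least m²t incidences would fall on at most 4t vertices, each with link at
  -- most m²/500.
  obtain ⟨p, hp, d, hd, hE⟩ : ∃ p ∈ Q, ∃ d ∈ B \ U, E p.1 p.2 d := by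
    by_contra! hno
    have hlow : #Q * t ≤ ∑ p ∈ Q, #{d ∈ U ∩ B | E p.1 p.2 d} := by
      rw [← smul_eq_mul, ← sum_const]
      refine sum_le_sum fun p hp => ?_
      have e1 := h.codegree_split (hQne p hp)
      have e2 : #{z ∈ A | E p.1 p.2 z} ≤ #A := card_filter_le _ _
      have e3 : #{z ∈ B | E p.1 p.2 z} ≤ #{d ∈ U ∩ B | E p.1 p.2 d} := by
        refine card_le_card fun z hz => ?_
        rw [mem_filter] at hz ⊢
        refine ⟨mem_inter.2 ⟨?_, hz.1⟩, hz.2⟩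
        by_contra hzU
        exact hno p hp z (mem_sdiff.2 ⟨hz.1, hzU⟩) hz.2
      omega
    have hcomm : ∑ p ∈ Q, #{d ∈ U ∩ B | E p.1 p.2 d} =
        ∑ d ∈ U ∩ B, #{p ∈ Q | E p.1 p.2 d} := by
      rw [← card_filter_product_eq_sum Q (U ∩ B) fun p d => E p.1 p.2 d,
        card_filter_product_eq_sum_right Q (U ∩ B) fun p d => E p.1 p.2 d]
    have hup : 500 * ∑ d ∈ U ∩ B, #{p ∈ Q | E p.1 p.2 d} ≤ #(U ∩ B) * m ^ 2 := by
      rw [mul_sum, ← smul_eq_mul (a := #(U ∩ B)), ← sum_const]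
      refine sum_le_sum fun d hd => ?_
      refine le_trans (Nat.mul_le_mul_left _ ?_) (h.link_B d (mem_inter.1 hd).2)
      refine card_le_card fun p hp => ?_
      rw [mem_filter] at hp ⊢
      refine ⟨product_subset_product sdiff_subset sdiff_subset (mem_filter.1 hp.1).1, ?_⟩
      exact h.triple.swap (h.triple.rot hp.2)
    rw [hcomm] at hlow
    have e1 : #(U ∩ B) * m ^ 2 ≤ 4 * t * m ^ 2 := Nat.mul_le_mul_right _ hUB
    have e2 : m ^ 2 * t ≤ #Q * t := Nat.mul_le_mul_right _ hQcard
    have e3 : 0 < t * m ^ 2 := by positivity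
    nlinarith
  obtain ⟨a, b⟩ := p
  simp only at hE
  have hab := hQne _ hp
  rw [hQ, mem_filter, mem_product, mem_sdiff, mem_sdiff] at hp
  simp only [Rich] at hp hab
  obtain ⟨⟨⟨haB, haU⟩, hbB, hbU⟩, hmAB⟩ := hp
  obtain ⟨hdB, hdU⟩ := mem_sdiff.1 hd
  have hCcard : m ≤ 2 * #({c ∈ A | E a b c} \ U) := by
    have e1 := card_sdiff_add_card_inter {c ∈ A | E a b c} U
    have e2 : #({c ∈ A | E a b c} ∩ U) ≤ #(U ∩ A) := by
      rw [inter_comm U]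
      exact card_le_card (inter_subset_inter_right (filter_subset _ _))
    omega
  have hEcard : 2 * m ≤ #((B \ U) \ {a, b, d}) := by
    have e1 := le_card_sdiff {a, b, d} (B \ U)
    have e2 := card_le_three (a := a) (b := b) (c := d)
    omega
  -- The edge `abd` lies inside `B`. Since `ab` is rich, `c` ranges over about `m` vertices, too
  -- many for the missing pairs at `d` to exclude every `c`, `e`.
  obtain ⟨c, hc, e, he, hdce⟩ := exists_pair_of_missCard_lt (E := E) (X := A) (Y := B) (v := d)
    (X' := {c ∈ A | E a b c} \ U) (Y' := (B \ U) \ {a, b, d})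
    (sdiff_subset.trans (filter_subset _ _)) (sdiff_subset.trans sdiff_subset) (by
      have e1 := h.miss_B d hdB
      have e2 := Nat.mul_le_mul hCcard hEcard
      have e3 : 0 < m ^ 2 := by positivity
      nlinarith)
  simp only [mem_sdiff, mem_filter, mem_insert, mem_singleton, not_or] at hc he
  obtain ⟨⟨hcA, habc⟩, hcU⟩ := hc
  obtain ⟨⟨heB, heU⟩, hea, heb, hed⟩ := he
  have hcB := h.notMem_B hcA
  refine ⟨a, b, c, d, e, ?_, ?_, habc, hE, h.triple.swap hdce, haB, hbB, hcA, hdB, heB⟩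
  · have had : a ≠ d := h.triple.ne (h.triple.rot hE)
    have hbd : b ≠ d := h.triple.ne (h.triple.rot (h.triple.swap hE))
    have hca : c ≠ a := fun hh => hcB (hh ▸ haB)
    have hcb : c ≠ b := fun hh => hcB (hh ▸ hbB)
    have hcd : c ≠ d := fun hh => hcB (hh ▸ hdB)
    have hce : c ≠ e := fun hh => hcB (hh ▸ heB)
    simp only [List.nodup_cons, List.mem_cons, List.not_mem_nil, or_false, not_or,
      not_false_eq_true, List.nodup_nil, and_true]
    exact ⟨⟨hab, hca.symm, had, Ne.symm hea⟩, ⟨hcb.symm, hbd, Ne.symm heb⟩, ⟨hcd, hce⟩,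
      Ne.symm hed⟩
  · simp only [List.mem_cons, List.not_mem_nil, or_false]
    rintro x (rfl | rfl | rfl | rfl | rfl) <;> assumption

/-- There is a generalised triangle with three vertices in `A`. -/
theorem exists_tile_three_two (h : NearExtremal E m A B Z) (hU : 10000 * #U ≤ m) :
    ∃ a b c d e, [a, b, c, d, e].Nodup ∧ (∀ x ∈ [a, b, c, d, e], x ∉ U) ∧ E a b c ∧ E a b d ∧
      E c d e ∧ #(({a, b, c, d, e} : Finset α) ∩ A) = 3 := by
  have hm := h.large
  have h1 := h.le_card
  have h1' := h.card_le
  have h2 := h.card_add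
  have h3 := h.card_exceptional
  have hm2 : 0 < m ^ 2 := by positivity
  have hsd : ∀ X : Finset α, #X ≤ #(X \ U) + #U := fun X => by
    have := le_card_sdiff U X; omega
  have hsd2 : ∀ X : Finset α, #X ≤ #((X \ U) \ Z) + #U + #Z := fun X => by
    have := le_card_sdiff U X; have := le_card_sdiff Z (X \ U); omega
  have hAcard := hsd2 A
  obtain ⟨x, hx, y, hy, hxy⟩ := one_lt_card.1 (show 1 < #((A \ U) \ Z) by omega)
  have hx' := hx
  have hy' := hy
  simp only [mem_sdiff] at hx' hy'
  obtain ⟨⟨hxA, hxU⟩, hxZ⟩ := hx'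
  obtain ⟨⟨hyA, hyU⟩, hyZ⟩ := hy'
  have hxB := h.notMem_B hxA
  have hyB := h.notMem_B hyA
  have hsplit := h.codegree_split hxy
  -- If `x`, `y` have many common neighbours in `A`, an edge `xyz` inside `A` is the last edge of
  -- the tile, and `a`, `b` come from the common link of `x` and `y` in `B`. Otherwise `xy` is the
  -- repeated pair, and a third typical vertex `z` has an edge to two of their common neighbours in
  -- `B`.
  rcases Nat.lt_or_ge #{z ∈ B | E x y z} m with hlt | hge
  · have hpos : 0 < #(({z ∈ A | E x y z} \ U) \ Z) := by
      have := hsd2 {z ∈ A | E x y z}; omega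
    obtain ⟨z, hz⟩ := card_pos.1 hpos
    simp only [mem_sdiff, mem_filter] at hz
    obtain ⟨⟨⟨hzA, hxyz⟩, hzU⟩, hzZ⟩ := hz
    have hzB := h.notMem_B hzA
    obtain ⟨a, ha, b, hb, hxab, hyab⟩ := exists_pair_of_missCard_add_lt (E := E) (X := B) (Y := B)
      (v := x) (w := y) (X' := B \ U) (Y' := B \ U) sdiff_subset sdiff_subset (by
        have e1 := h.miss_typical x hxA hxZ
        have e2 := h.miss_typical y hyA hyZ
        have e3 : m ≤ #(B \ U) := by have := hsd B; omega
        have e4 := Nat.mul_le_mul e3 e3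
        nlinarith)
    obtain ⟨haB, haU⟩ := mem_sdiff.1 ha
    obtain ⟨hbB, hbU⟩ := mem_sdiff.1 hb
    have haA := h.notMem_A haB
    have hbA := h.notMem_A hbB
    have hn : [a, b, x, y, z].Nodup := by
      have e1 : a ≠ b := h.triple.ne (h.triple.rot (h.triple.swap hxab))
      have e2 : x ≠ z := h.triple.ne (h.triple.rot hxyz)
      have e3 : y ≠ z := h.triple.ne (h.triple.rot (h.triple.swap hxyz))
      simp only [List.nodup_cons, List.mem_cons, List.not_mem_nil, or_false, not_or,
        not_false_eq_true, List.nodup_nil, and_true]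
      refine ⟨⟨e1, ?_, ?_, ?_⟩, ⟨?_, ?_, ?_⟩, ⟨hxy, e2⟩, e3⟩ <;> (rintro rfl; contradiction)
    refine ⟨a, b, x, y, z, hn, ?_, ?_, ?_, hxyz, ?_⟩
    · simp only [List.mem_cons, List.not_mem_nil, or_false]
      rintro w (rfl | rfl | rfl | rfl | rfl) <;> assumption
    · exact h.triple.rot (h.triple.swap hxab)
    · exact h.triple.rot (h.triple.swap hyab)
    · have := card_union_five_inter (U := ∅) (X := A) hn (by simp)
      simpa [haA, hbA, hxA, hyA, hzA] using this
  · have hpos : 2 < #((A \ U) \ Z) := by omega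
    obtain ⟨z, hz, hzx, hzy⟩ : ∃ z ∈ (A \ U) \ Z, z ≠ x ∧ z ≠ y := by
      have : 0 < #(((A \ U) \ Z) \ {x, y}) := by
        have := le_card_sdiff {x, y} ((A \ U) \ Z)
        have := card_le_two (a := x) (b := y)
        omega
      obtain ⟨z, hz⟩ := card_pos.1 this
      simp only [mem_sdiff (s := (A \ U) \ Z), mem_insert, mem_singleton, not_or] at hz
      exact ⟨z, hz.1, hz.2⟩
    simp only [mem_sdiff] at hz
    obtain ⟨⟨hzA, hzU⟩, hzZ⟩ := hz
    have hzB := h.notMem_B hzA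
    obtain ⟨c, hc, d, hd, hzcd⟩ := exists_pair_of_missCard_lt (E := E) (X := B) (Y := B)
      (v := z) (X' := {z ∈ B | E x y z} \ U) (Y' := {z ∈ B | E x y z} \ U)
      (sdiff_subset.trans (filter_subset _ _)) (sdiff_subset.trans (filter_subset _ _)) (by
        have e1 := h.miss_typical z hzA hzZ
        have e3 : m ≤ 2 * #({z ∈ B | E x y z} \ U) := by
          have := hsd {z ∈ B | E x y z}; omega
        have e4 := Nat.mul_le_mul e3 e3
        nlinarith)
    simp only [mem_sdiff, mem_filter] at hc hd
    obtain ⟨⟨hcB, hxyc⟩, hcU⟩ := hc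
    obtain ⟨⟨hdB, hxyd⟩, hdU⟩ := hd
    have hcA := h.notMem_A hcB
    have hdA := h.notMem_A hdB
    have hn : [x, y, c, d, z].Nodup := by
      have e1 : c ≠ d := h.triple.ne (h.triple.rot (h.triple.swap hzcd))
      simp only [List.nodup_cons, List.mem_cons, List.not_mem_nil, or_false, not_or,
        not_false_eq_true, List.nodup_nil, and_true]
      refine ⟨⟨hxy, ?_, ?_, Ne.symm hzx⟩, ⟨?_, ?_, Ne.symm hzy⟩, ⟨e1, ?_⟩, ?_⟩ <;>
        (rintro rfl; contradiction)
    refine ⟨x, y, c, d, z, hn, ?_, hxyc, hxyd, h.triple.rot (h.triple.swap hzcd), ?_⟩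
    · simp only [List.mem_cons, List.not_mem_nil, or_false]
      rintro w (rfl | rfl | rfl | rfl | rfl) <;> assumption
    · have := card_union_five_inter (U := ∅) (X := A) hn (by simp)
      simpa [hcA, hdA, hxA, hyA, hzA] using this

/-- Every exceptional vertex lies in a generalised triangle with two vertices in `A`. -/
theorem exists_tile_exceptional (h : NearExtremal E m A B Z) (hU : 20000 * #U ≤ m) {v : α}
    (hv : v ∈ Z) (hvU : v ∉ U) :
    ∃ a b c d, [a, b, c, d, v].Nodup ∧ (∀ x ∈ [a, b, c, d, v], x ∉ U) ∧ E a b c ∧ E a b d ∧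
      E c d v ∧ a ∈ A ∧ b ∈ B ∧ c ∈ B ∧ d ∈ B := by
  have hm := h.large
  have h1 := h.le_card
  have h1' := h.card_le
  have h2 := h.card_add
  have h3 := h.card_exceptional
  have hm2 : 0 < m ^ 2 := by positivity
  have hvA := h.sub hv
  have hvB := h.notMem_B hvA
  have hUB : #(B ∩ U) ≤ #U := card_le_card inter_subset_right
  -- `U` meets at most 2 · (m/20000) · 4m = m²/2500 link pairs of `v`, fewer than the m²/2000
  -- available.
  obtain ⟨c, hc, d, hd, hvcd⟩ : ∃ c ∈ B \ U, ∃ d ∈ B \ U, E v c d := by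
    by_contra! hno
    have hsub : linkCard E B B v ≤ #((B ∩ U) ×ˢ B ∪ B ×ˢ (B ∩ U)) := by
      refine card_le_card fun p hp => ?_
      simp only [mem_filter, mem_product, mem_union, mem_inter] at hp ⊢
      have := fun h1 h2 => hno p.1 h1 p.2 h2 hp.2
      simp only [mem_sdiff] at this
      tauto
    have e1 := card_union_le ((B ∩ U) ×ˢ B) (B ×ˢ (B ∩ U))
    rw [card_product, card_product] at e1
    have e2 := h.link_exceptional v hv
    have e3 : #B ≤ 4 * m := by omega
    have e4 : 20000 * #(B ∩ U) * #B ≤ m * (4 * m) := Nat.mul_le_mul (by omega) e3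
    nlinarith
  obtain ⟨hcB, hcU⟩ := mem_sdiff.1 hc
  obtain ⟨hdB, hdU⟩ := mem_sdiff.1 hd
  obtain ⟨a, ha, b, hb, hcab, hdab⟩ := exists_pair_of_missCard_add_lt (E := E) (X := A) (Y := B)
    (v := c) (w := d) (X' := (A \ U) \ Z) (Y' := (B \ U) \ {c, d})
    (sdiff_subset.trans sdiff_subset) (sdiff_subset.trans sdiff_subset) (by
      have e1 := h.miss_B c hcB
      have e2 := h.miss_B d hdB
      have e3 : m ≤ #((A \ U) \ Z) := by
        have := le_card_sdiff U A; have := le_card_sdiff Z (A \ U); omega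
      have e4 : m ≤ #((B \ U) \ {c, d}) := by
        have := le_card_sdiff U B
        have := le_card_sdiff {c, d} (B \ U)
        have := card_le_two (a := c) (b := d)
        omega
      have e5 := Nat.mul_le_mul e3 e4
      nlinarith)
  simp only [mem_sdiff, mem_insert, mem_singleton, not_or] at ha hb
  obtain ⟨⟨haA, haU⟩, haZ⟩ := ha
  obtain ⟨⟨hbB, hbU⟩, hbc, hbd⟩ := hb
  have haB := h.notMem_B haA
  refine ⟨a, b, c, d, ?_, ?_, h.triple.rot (h.triple.swap hcab), h.triple.rot (h.triple.swap hdab),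
    h.triple.rot (h.triple.swap hvcd), haA, hbB, hcB, hdB⟩
  · have e1 : c ≠ d := h.triple.ne (h.triple.rot (h.triple.swap hvcd))
    simp only [List.nodup_cons, List.mem_cons, List.not_mem_nil, or_false, not_or,
      not_false_eq_true, List.nodup_nil, and_true]
    refine ⟨⟨?_, ?_, ?_, ?_⟩, ⟨hbc, hbd, ?_⟩, ⟨e1, ?_⟩, ?_⟩ <;> (rintro rfl; contradiction)
  · simp only [List.mem_cons, List.not_mem_nil, or_false]
    rintro w (rfl | rfl | rfl | rfl | rfl) <;> assumption

end NearExtremal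

end Tiles

/-! ### Balancing, absorbing exceptional vertices, and completing the tiling -/

section Assembly

open scoped Classical

variable {α : Type*} [Fintype α]

namespace NearExtremal

variable {E : α → α → α → Prop} {m : ℕ} {A B Z U : Finset α}

theorem card_inter_add (h : NearExtremal E m A B Z) (U : Finset α) :
    #(U ∩ A) + #(U ∩ B) = #U := by
  rw [h.compl, ← sdiff_eq_inter_compl, card_sdiff_add_card_inter]

/-- A few disjoint tiles restore the ratio `2 : 3` between the two parts. -/
theorem exists_tileable_balanced (h : NearExtremal E m A B Z) :
    ∃ U, Tileable E U ∧ 3 * #A + 2 * #(U ∩ B) = 2 * #B + 3 * #(U ∩ A) ∧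
      1000000 * #U ≤ 5 * m := by
  have hm := h.large
  have h1 := h.le_card
  have h1' := h.card_le
  have h2 := h.card_add
  rcases le_total #A (2 * m) with hle | hle
  -- With sizes 2m - t and 3m + t, removing t tiles of type 1+4 leaves 2(m - t) and 3(m - t).
  · obtain ⟨t, ht⟩ := Nat.exists_eq_add_of_le hle
    have key : ∀ s ≤ t, ∃ U, Tileable E U ∧ #(U ∩ A) = s ∧ #(U ∩ B) = 4 * s := by
      intro s
      induction s with
      | zero => exact fun _ => ⟨∅, .empty, by simp, by simp⟩
      | succ s ih =>
        intro hs
        obtain ⟨U, hU, hUA, hUB⟩ := ih (by omega)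
        obtain ⟨a, b, c, d, e, hn, hd, e1, e2, e3, haB, hbB, hcA, hdB, heB⟩ :=
          h.exists_tile_one_four (U := U) (t := t) (by omega) (by omega) (by omega) (by omega)
        refine ⟨_, hU.add hn hd e1 e2 e3, ?_, ?_⟩
        · rw [card_union_five_inter hn hd]
          simp [h.notMem_A haB, h.notMem_A hbB, hcA, h.notMem_A hdB, h.notMem_A heB, hUA]
        · rw [card_union_five_inter hn hd]
          simp [haB, hbB, h.notMem_B hcA, hdB, heB, hUB]
          ring
    obtain ⟨U, hU, hUA, hUB⟩ := key t le_rfl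
    have := h.card_inter_add U
    exact ⟨U, hU, by omega, by omega⟩
  -- With sizes 2m + t and 3m - t, removing t tiles of type 3+2 also leaves 2(m - t) and 3(m - t).
  · obtain ⟨t, ht⟩ := Nat.exists_eq_add_of_le hle
    have key : ∀ s ≤ t, ∃ U, Tileable E U ∧ #(U ∩ A) = 3 * s ∧ #(U ∩ B) = 2 * s := by
      intro s
      induction s with
      | zero => exact fun _ => ⟨∅, .empty, by simp, by simp⟩
      | succ s ih =>
        intro hs
        obtain ⟨U, hU, hUA, hUB⟩ := ih (by omega)
        have hUc := h.card_inter_add U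
        obtain ⟨a, b, c, d, e, hn, hd, e1, e2, e3, hA3⟩ :=
          h.exists_tile_three_two (U := U) (by omega)
        have e4 : #((U ∪ {a, b, c, d, e}) ∩ A) = #(U ∩ A) + 3 := by
          rw [card_union_five_inter hn hd, ← hA3]
          have := card_union_five_inter (U := ∅) (X := A) hn (by simp)
          simp only [empty_union, empty_inter, card_empty, zero_add] at this
          rw [this]
        have e5 : #(U ∪ {a, b, c, d, e}) = #U + 5 := by
          have := card_union_five_inter (U := U) (X := univ) hn hd
          simpa using this
        have e6 := h.card_inter_add (U ∪ {a, b, c, d, e})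
        exact ⟨_, hU.add hn hd e1 e2 e3, by omega, by omega⟩
    obtain ⟨U, hU, hUA, hUB⟩ := key t le_rfl
    have := h.card_inter_add U
    exact ⟨U, hU, by omega, by omega⟩

/-- The exceptional vertices can be covered by a few further tiles without changing the ratio. -/
theorem exists_tileable_exceptional (h : NearExtremal E m A B Z) :
    ∃ U, Tileable E U ∧ Z ⊆ U ∧ 3 * #A + 2 * #(U ∩ B) = 2 * #B + 3 * #(U ∩ A) ∧
      20000 * #U ≤ m := by
  have hm := h.large
  have h3 := h.card_exceptional
  -- Each exceptional vertex costs at most one tile; those already covered cost none. The tiles have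
  -- type 2+3, so the balance persists.
  have key : ∀ Y ⊆ Z, ∃ U, Tileable E U ∧ Y ⊆ U ∧
      3 * #A + 2 * #(U ∩ B) = 2 * #B + 3 * #(U ∩ A) ∧
      1000000 * #U ≤ 5 * m + 5000000 * #Y := by
    intro Y
    induction Y using Finset.induction_on with
    | empty =>
      intro _
      obtain ⟨U, hU, hbal, hc⟩ := h.exists_tileable_balanced
      exact ⟨U, hU, empty_subset _, hbal, by simpa using hc⟩
    | insert v Y hv ih =>
      intro hY
      obtain ⟨hvZ, hYZ⟩ := insert_subset_iff.1 hY
      obtain ⟨U, hU, hYU, hbal, hc⟩ := ih hYZ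
      have hYc := card_le_card hYZ
      rw [card_insert_of_notMem hv]
      by_cases hvU : v ∈ U
      · exact ⟨U, hU, insert_subset hvU hYU, hbal, by omega⟩
      obtain ⟨a, b, c, d, hn, hd, e1, e2, e3, haA, hbB, hcB, hdB⟩ :=
        h.exists_tile_exceptional (U := U) (by omega) hvZ hvU
      have hvA := h.sub hvZ
      have e4 : #((U ∪ {a, b, c, d, v}) ∩ A) = #(U ∩ A) + 2 := by
        rw [card_union_five_inter hn hd]
        simp [haA, h.notMem_A hbB, h.notMem_A hcB, h.notMem_A hdB, hvA]
      have e5 : #((U ∪ {a, b, c, d, v}) ∩ B) = #(U ∩ B) + 3 := by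
        rw [card_union_five_inter hn hd]
        simp [hbB, h.notMem_B haA, hcB, hdB, h.notMem_B hvA]
      have e6 := h.card_inter_add (U ∪ {a, b, c, d, v})
      have e7 := h.card_inter_add U
      refine ⟨_, hU.add hn hd e1 e2 e3, insert_subset ?_ ?_, by omega, by omega⟩
      · simp
      · exact hYU.trans subset_union_left
  obtain ⟨U, hU, hZU, hbal, hc⟩ := key Z subset_rfl
  exact ⟨U, hU, hZU, hbal, by omega⟩

/-- Missing pairs are rare at vertices of `B` and at typical vertices of `A`; the weaker of the two
bounds, the one for `B`, sets the constant. This is why `Z` has to be covered beforehand. -/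
theorem rarelyFails (h : NearExtremal E m A B Z) {k : ℕ} {f g g' : Fin k → α}
    (hf : Function.Injective f) (hg : Function.Injective g) (hg' : Function.Injective g')
    (hfA : ∀ i, f i ∈ A ∧ f i ∉ Z) (hgB : ∀ i, g i ∈ B) (hgB' : ∀ i, g' i ∈ B) :
    RarelyFails (3 * m ^ 2 / 1000) fun x y z => E (f x) (g y) (g' z) := by
  have key : ∀ {f₁ f₂ : Fin k → α} {X Y : Finset α} (v : α) (S : Set (Fin k × Fin k)),
      Function.Injective f₁ → Function.Injective f₂ → (∀ i, f₁ i ∈ X) → (∀ i, f₂ i ∈ Y) →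
      (∀ p ∈ S, ¬ E v (f₁ p.1) (f₂ p.2)) → 1000 * missCard E X Y v ≤ 3 * m ^ 2 →
      S.ncard ≤ 3 * m ^ 2 / 1000 := by
    intro f₁ f₂ X Y v S h₁ h₂ hX hY hS hv
    have : S.ncard ≤ missCard E X Y v := by
      rw [missCard, ← Set.ncard_coe_finset]
      refine Set.ncard_le_ncard_of_injOn (fun p => (f₁ p.1, f₂ p.2)) ?_ ?_
      · intro p hp
        simpa using ⟨⟨hX p.1, hY p.2⟩, hS p hp⟩
      · rintro ⟨a, b⟩ - ⟨c, d⟩ - hh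
        simp only [Prod.mk.injEq] at hh ⊢
        exact ⟨h₁ hh.1, h₂ hh.2⟩
    omega
  refine ⟨fun x => ?_, fun y => ?_, fun z => ?_⟩
  · refine key (f x) _ hg hg' hgB hgB' (fun p hp => hp) ?_
    have := h.miss_typical _ (hfA x).1 (hfA x).2
    omega
  · exact key (g y) _ hf hg' (fun i => (hfA i).1) hgB' (fun p hp hE => hp (h.triple.swap hE))
      (h.miss_B _ (hgB y))
  · exact key (g' z) _ hf hg (fun i => (hfA i).1) hgB
      (fun p hp hE => hp (h.triple.rot (h.triple.swap hE))) (h.miss_B _ (hgB' z))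

/-- A near-extremal triple system has a perfect tiling by generalised triangles. -/
theorem tileable_univ (h : NearExtremal E m A B Z) : Tileable E univ := by
  obtain ⟨U, hU, hZU, hbal, hUc⟩ := h.exists_tileable_exceptional
  have hm := h.large
  have h1 := h.le_card
  have h1' := h.card_le
  have h2 := h.card_add
  have hAU : #(A \ U) + #(U ∩ A) = #A := by rw [inter_comm]; exact card_sdiff_add_card_inter _ _
  have hBU : #(B \ U) + #(U ∩ B) = #B := by rw [inter_comm]; exact card_sdiff_add_card_inter _ _
  have hUAB := h.card_inter_add U
  obtain ⟨k, hAk, hBk⟩ : ∃ k, #(A \ U) = 2 * k ∧ #(B \ U) = 3 * k :=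
    ⟨#(A \ U) / 2, by omega, by omega⟩
  let f : Fin 2 × Fin k ≃ ↥(A \ U) := finProdFinEquiv.trans (equivFinOfCardEq hAk).symm
  let g : Fin 3 × Fin k ≃ ↥(B \ U) := finProdFinEquiv.trans (equivFinOfCardEq hBk).symm
  have hfA : ∀ p, (f p : α) ∈ A := fun p => (mem_sdiff.1 (f p).2).1
  have hfU : ∀ p, (f p : α) ∉ U := fun p => (mem_sdiff.1 (f p).2).2
  have hgB : ∀ p, (g p : α) ∈ B := fun p => (mem_sdiff.1 (g p).2).1
  have hgU : ∀ p, (g p : α) ∉ U := fun p => (mem_sdiff.1 (g p).2).2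
  have hfinj : ∀ p q, (f p : α) = f q ↔ p = q := fun p q => by
    rw [Subtype.coe_inj, f.injective.eq_iff]
  have hginj : ∀ p q, (g p : α) = g q ↔ p = q := fun p q => by
    rw [Subtype.coe_inj, g.injective.eq_iff]
  have hfg : ∀ p q, (f p : α) ≠ g q := fun p q hh => h.notMem_B (hfA p) (hh ▸ hgB q)
  have hfj : ∀ j, Function.Injective fun i => (f (j, i) : α) := fun j a b hh => by
    simpa [hfinj] using hh
  have hgj : ∀ j, Function.Injective fun i => (g (j, i) : α) := fun j a b hh => by
    simpa [hginj] using hh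
  have hfZ : ∀ j i, (f (j, i) : α) ∈ A ∧ (f (j, i) : α) ∉ Z :=
    fun j i => ⟨hfA _, fun hz => hfU _ (hZU hz)⟩
  -- In the tile `a`, `b`, `c`, `d`, `e`, the vertices `a` and `e` come from `A`, so that each of
  -- `abc`, `abd`, `cde` has exactly one vertex in `A`.
  obtain ⟨π, hπ⟩ := exists_perm_forall_of_rarelyFails
    (fun x y z => E (f (0, x)) (g (0, y)) (g (1, z)))
    (fun x y z => E (f (0, x)) (g (0, y)) (g (2, z)))
    (fun x y z => E (f (1, x)) (g (1, y)) (g (2, z)))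
    (h.rarelyFails (hfj 0) (hgj 0) (hgj 1) (hfZ 0) (fun _ => hgB _) (fun _ => hgB _))
    (h.rarelyFails (hfj 0) (hgj 0) (hgj 2) (hfZ 0) (fun _ => hgB _) (fun _ => hgB _))
    (h.rarelyFails (hfj 1) (hgj 1) (hgj 2) (hfZ 1) (fun _ => hgB _) (fun _ => hgB _))
    (by
      have e1 : 1000 * (3 * m ^ 2 / 1000) ≤ 3 * m ^ 2 := Nat.mul_div_le _ _
      have e2 : m ≤ 2 * k := by omega
      have e3 := Nat.mul_le_mul e2 e2
      have e4 : 40 * k < k * k := Nat.mul_lt_mul_of_pos_right (by omega) (by omega)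
      nlinarith)
  let tile : Fin k → Finset α := fun i => {(f (0, π 0 i) : α), (g (0, π 1 i) : α),
    (g (1, π 2 i) : α), (g (2, π 3 i) : α), (f (1, π 4 i) : α)}
  have key : ∀ s : Finset (Fin k), Tileable E (U ∪ s.biUnion tile) := by
    intro s
    induction s using Finset.induction_on with
    | empty => simpa using hU
    | insert i s hi ih =>
      have heq : U ∪ (insert i s).biUnion tile = (U ∪ s.biUnion tile) ∪ tile i := by
        rw [biUnion_insert, union_assoc, union_comm (tile i)]
      rw [heq]
      obtain ⟨e1, e2, e3⟩ := hπ i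
      refine ih.add ?_ ?_ e1 e2 (h.triple.rot (h.triple.swap e3))
      · have hgf : ∀ p q, (g p : α) ≠ f q := fun p q => (hfg q p).symm
        simp [hfinj, hginj, hfg, hgf]
      · have hgf : ∀ p q, (g p : α) ≠ f q := fun p q => (hfg q p).symm
        have hne : ∀ j ∈ s, ¬ i = j := fun j hj hij => hi (hij ▸ hj)
        intro x hx
        simp only [List.mem_cons, List.not_mem_nil, or_false] at hx
        rcases hx with rfl | rfl | rfl | rfl | rfl <;>
          simpa [hfU, hgU, tile, hfinj, hginj, hfg, hgf] using hne
  have huniv : U ∪ univ.biUnion tile = univ := by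
    refine eq_univ_iff_forall.2 fun x => ?_
    by_cases hxU : x ∈ U
    · exact mem_union_left _ hxU
    refine mem_union_right _ (mem_biUnion.2 ?_)
    by_cases hxB : x ∈ B
    · obtain ⟨⟨j, i⟩, hji⟩ := g.surjective ⟨x, mem_sdiff.2 ⟨hxB, hxU⟩⟩
      have hx : (g (j, i) : α) = x := congrArg Subtype.val hji
      fin_cases j
      · exact ⟨(π 1).symm i, mem_univ _, by simp [tile, ← hx]⟩
      · exact ⟨(π 2).symm i, mem_univ _, by simp [tile, ← hx]⟩
      · exact ⟨(π 3).symm i, mem_univ _, by simp [tile, ← hx]⟩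
    · have hxA : x ∈ A := by rw [h.compl]; simpa using hxB
      obtain ⟨⟨j, i⟩, hji⟩ := f.surjective ⟨x, mem_sdiff.2 ⟨hxA, hxU⟩⟩
      have hx : (f (j, i) : α) = x := congrArg Subtype.val hji
      fin_cases j
      · exact ⟨(π 0).symm i, mem_univ _, by simp [tile, ← hx]⟩
      · exact ⟨(π 4).symm i, mem_univ _, by simp [tile, ← hx]⟩
  have := key univ
  rwa [huniv] at this

end NearExtremal

end Assembly

/-! ### From a sparse set to a near-extremal partition -/

section Stability

open scoped Classical

variable {α : Type*}

/-- Replacing the set `X` by `Y` changes a pair count by at most the pairs meeting `X \ Y`. -/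
theorem card_filter_product_le_add (X Y : Finset α) (P : α × α → Prop) [DecidablePred P] :
    #{p ∈ X ×ˢ X | P p} ≤ #{p ∈ Y ×ˢ Y | P p} + 2 * (#(X \ Y) * #X) := by
  have hsub : ({p ∈ X ×ˢ X | P p} : Finset (α × α)) ⊆
      {p ∈ Y ×ˢ Y | P p} ∪ ((X \ Y) ×ˢ X ∪ X ×ˢ (X \ Y)) := by
    intro p hp
    simp only [mem_filter, mem_union, mem_product, mem_sdiff] at hp ⊢
    tauto
  refine (card_le_card hsub).trans ((card_union_le _ _).trans ?_)
  have := card_union_le ((X \ Y) ×ˢ X) (X ×ˢ (X \ Y))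
  rw [card_product, card_product] at this
  nlinarith

/-- A Markov inequality, used to bound the number of atypical vertices. -/
theorem card_mul_le_sum_of_forall_le {X : Finset α} {f : α → ℕ} {c N : ℕ} {Y : Finset α}
    (hYX : Y ⊆ X) (h : ∀ v ∈ Y, N ≤ c * f v) : #Y * N ≤ c * ∑ v ∈ X, f v := by
  rw [mul_sum]
  exact (card_nsmul_le_sum Y (fun v => c * f v) N h).trans (sum_le_sum_of_subset hYX)

variable {E : α → α → α → Prop} {m : ℕ}

theorem linkCard_add_missCard (X Y : Finset α) (v : α) :
    linkCard E X Y v + missCard E X Y v = #X * #Y := by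
  rw [← card_product]
  exact card_filter_add_card_filter_not (s := X ×ˢ Y) (fun p => E v p.1 p.2)

variable [Fintype α]

theorem two_mul_le_card_compl_add (hcod : ∀ x y, x ≠ y → 2 * m ≤ #{z | E x y z}) (B : Finset α)
    {x y : α} (hxy : x ≠ y) : 2 * m ≤ #{z ∈ Bᶜ | E x y z} + #{z ∈ B | E x y z} := by
  refine (hcod x y hxy).trans ((card_le_card ?_).trans (card_union_le _ _))
  intro z hz
  simp only [mem_filter, mem_univ, true_and, mem_union, mem_compl] at hz ⊢
  tauto

/-- If `B` has exactly complementary size, missing triples are compensated by edges inside `B`. -/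
theorem sum_missCard_compl_le (hE : IsTripleSystem E)
    (hcod : ∀ x y, x ≠ y → 2 * m ≤ #{z | E x y z}) {B : Finset α} (hB : #B = 3 * m)
    (hBc : #Bᶜ = 2 * m) :
    ∑ a ∈ Bᶜ, missCard E B B a ≤ ∑ b ∈ B, linkCard E B B b + 6 * m ^ 2 := by
  have e1 : ∑ a ∈ Bᶜ, missCard E B B a = ∑ p ∈ B ×ˢ B, #{a ∈ Bᶜ | ¬ E a p.1 p.2} := by
    simp only [missCard]
    rw [← card_filter_product_eq_sum Bᶜ (B ×ˢ B) fun a p => ¬ E a p.1 p.2,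
      card_filter_product_eq_sum_right Bᶜ (B ×ˢ B) fun a p => ¬ E a p.1 p.2]
  have e2 : ∑ b ∈ B, linkCard E B B b = ∑ p ∈ B ×ˢ B, #{b ∈ B | E b p.1 p.2} := by
    simp only [linkCard]
    rw [← card_filter_product_eq_sum B (B ×ˢ B) fun a p => E a p.1 p.2,
      card_filter_product_eq_sum_right B (B ×ˢ B) fun a p => E a p.1 p.2]
  -- Degenerate pairs have no codegree bound; the diagonal contributes at most 3m · 2m.
  have e3 : ∑ p ∈ B ×ˢ B, (if p.1 = p.2 then 2 * m else 0) = 6 * m ^ 2 := by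
    rw [sum_product]
    have : ∀ x ∈ B, ∑ y ∈ B, (if x = y then 2 * m else 0) = 2 * m := by
      intro x hx
      rw [sum_ite_eq, if_pos hx]
    rw [sum_congr rfl this, sum_const, hB, smul_eq_mul]
    ring
  rw [e1, e2, ← e3, ← sum_add_distrib]
  refine sum_le_sum fun p _ => ?_
  have e4 := card_filter_add_card_filter_not (s := Bᶜ) (fun a => E a p.1 p.2)
  split_ifs with hp
  · omega
  · have e5 := two_mul_le_card_compl_add hcod B hp
    have hrot : ∀ z, E p.1 p.2 z ↔ E z p.1 p.2 := fun z =>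
      ⟨fun h => hE.swap (hE.rot h), fun h => hE.rot (hE.swap h)⟩
    simp only [hrot] at e5
    omega

/-- A vertex with few link pairs inside `B` has almost all link pairs between `Bᶜ` and `B`. -/
theorem missCard_compl_le (hE : IsTripleSystem E)
    (hcod : ∀ x y, x ≠ y → 2 * m ≤ #{z | E x y z}) (B : Finset α) (v : α) :
    missCard E Bᶜ B v ≤ #B * (#Bᶜ - 2 * m) + linkCard E B B v + #Bᶜ := by
  rw [missCard, linkCard, card_filter_product_eq_sum_right Bᶜ B fun a x => ¬ E v a x,
    card_filter_product_eq_sum_right B B fun a x => E v a x]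
  -- The codegree bound is unavailable at `x = v`, which costs one extra term `#Bᶜ`.
  have e1 : ∑ x ∈ B, (if v = x then #Bᶜ else 0) ≤ #Bᶜ := by
    rw [sum_ite_eq]; split_ifs <;> simp
  refine le_trans ?_ (Nat.add_le_add_left e1 _)
  rw [← smul_eq_mul, ← sum_const, ← sum_add_distrib, ← sum_add_distrib]
  refine sum_le_sum fun x _ => ?_
  have e4 := card_filter_add_card_filter_not (s := Bᶜ) (fun a => E v a x)
  split_ifs with hp
  · omega
  · have e5 := two_mul_le_card_compl_add hcod B hp
    have hrot : ∀ z, E v x z ↔ E v z x := fun z => ⟨hE.rot, hE.rot⟩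
    simp only [hrot] at e5
    omega

/-- A triple system of minimum codegree `2 * m` on `5 * m` vertices with a sparse set of `3 * m`
vertices has a perfect tiling by generalised triangles. -/
theorem tileable_univ_of_sparse (hE : IsTripleSystem E)
    (hcod : ∀ x y, x ≠ y → 2 * m ≤ #{z | E x y z}) (hcard : Fintype.card α = 5 * m)
    (hm : 10000000000 ≤ m) {B₀ : Finset α} (hB₀ : #B₀ = 3 * m)
    (hsparse : 1000000000 * ∑ b ∈ B₀, linkCard E B₀ B₀ b ≤ m ^ 3) : Tileable E univ := by
  have hm2 : 0 < m ^ 2 := by positivity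
  have hB₀c : #B₀ᶜ = 2 * m := by rw [card_compl]; omega
  have hT : 1000000000 * ∑ a ∈ B₀ᶜ, missCard E B₀ B₀ a ≤ 2 * m ^ 3 := by
    have e1 := sum_missCard_compl_le hE hcod hB₀ hB₀c
    have e2 : 10000000000 * m ^ 2 ≤ m * m ^ 2 := Nat.mul_le_mul_right _ hm
    nlinarith
  -- All vertices are reclassified by their link in `B₀`, including those outside `B₀`. Thus every
  -- vertex left out of `B`, and in particular of `Z`, has a link of size at least m²/1000 there.
  let B : Finset α := {v | 1000 * linkCard E B₀ B₀ v < m ^ 2}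
  let Z : Finset α := {v ∈ Bᶜ | m ^ 2 < 1000 * missCard E B₀ B₀ v}
  have hBmem : ∀ v, v ∈ B ↔ 1000 * linkCard E B₀ B₀ v < m ^ 2 := fun v => by simp [B]
  have hcancel : ∀ {x y : ℕ}, x * m ^ 2 ≤ y * m * m ^ 2 → x ≤ y * m :=
    fun h => Nat.le_of_mul_le_mul_right h hm2
  have hout : 1000000 * #(B₀ \ B) ≤ m := by
    have e1 := card_mul_le_sum_of_forall_le (X := B₀) (f := linkCard E B₀ B₀) (c := 1000)
      (N := m ^ 2) (Y := B₀ \ B) sdiff_subset (fun v hv => by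
        have := (mem_sdiff.1 hv).2
        rw [hBmem] at this
        omega)
    have := hcancel (x := 1000000 * #(B₀ \ B)) (y := 1) (by nlinarith)
    omega
  -- A vertex of small link misses nearly all of the 9m² pairs in `B₀ × B₀`, so by `hT` few such
  -- vertices lie outside `B₀`.
  have hin : 1000000000 * #(B \ B₀) ≤ m := by
    have e1 := card_mul_le_sum_of_forall_le (X := B₀ᶜ) (f := missCard E B₀ B₀) (c := 1)
      (N := 8 * m ^ 2) (Y := B \ B₀) (fun v hv => by
        rw [mem_compl]; exact (mem_sdiff.1 hv).2) (fun v hv => by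
        have h1 := (mem_sdiff.1 hv).1
        rw [hBmem] at h1
        have h2 := linkCard_add_missCard (E := E) B₀ B₀ v
        rw [hB₀] at h2
        nlinarith)
    have := hcancel (x := 1000000000 * #(B \ B₀)) (y := 1) (by nlinarith)
    omega
  -- Outside `B₀` the vertices of `Z` are bounded through `hT`; inside they are among the few
  -- vertices of `B₀ \ B`.
  have hZ : 1000000 * #Z ≤ 3 * m := by
    have e1 := card_mul_le_sum_of_forall_le (X := B₀ᶜ) (f := missCard E B₀ B₀) (c := 1000)
      (N := m ^ 2) (Y := Z \ B₀) (fun v hv => by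
        rw [mem_compl]; exact (mem_sdiff.1 hv).2) (fun v hv =>
        (mem_filter.1 (mem_sdiff.1 hv).1).2.le)
    have e2 := hcancel (x := 1000000 * #(Z \ B₀)) (y := 2) (by nlinarith)
    have e3 : #(Z ∩ B₀) ≤ #(B₀ \ B) := card_le_card fun v hv => by
      obtain ⟨h1, h2⟩ := mem_inter.1 hv
      exact mem_sdiff.2 ⟨h2, mem_compl.1 (mem_filter.1 h1).1⟩
    have e4 := card_sdiff_add_card_inter Z B₀
    omega
  have hBB₀ : #B + #(B₀ \ B) = #B₀ + #(B \ B₀) := by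
    have e1 := card_sdiff_add_card_inter B B₀
    have e2 := card_sdiff_add_card_inter B₀ B
    rw [inter_comm] at e2
    omega
  have hcompl : #Bᶜ + #B = 5 * m := by
    rw [← hcard, add_comm]; exact card_add_card_compl B
  have hprod : 1000000000 * (#(B \ B₀) * #B) ≤ 4 * m ^ 2 := by
    have := Nat.mul_le_mul hin (show #B ≤ 4 * m by omega)
    nlinarith
  have hprod' : 1000000 * (#(B₀ \ B) * #B₀) ≤ 3 * m ^ 2 := by
    have := Nat.mul_le_mul hout hB₀.le
    nlinarith
  have hlink : ∀ v ∈ B, 500 * linkCard E B B v ≤ m ^ 2 ∧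
      1000 * linkCard E B B v ≤ m ^ 2 + m ^ 2 / 100 := by
    intro v hv
    rw [hBmem] at hv
    have e1 : linkCard E B B v ≤ linkCard E B₀ B₀ v + 2 * (#(B \ B₀) * #B) :=
      card_filter_product_le_add B B₀ fun p => E v p.1 p.2
    omega
  refine NearExtremal.tileable_univ (m := m) (A := Bᶜ) (B := B) (Z := Z)
    { triple := hE
      codegree := hcod
      compl := rfl
      large := by omega
      card_add := hcompl
      card_le := by omega
      le_card := by omega
      sub := filter_subset _ _
      card_exceptional := by omega
      miss_typical := ?_
      link_exceptional := ?_
      link_B := fun v hv => (hlink v hv).1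
      miss_B := ?_ }
  · intro v hv hvZ
    have e1 : missCard E B B v ≤ missCard E B₀ B₀ v + 2 * (#(B \ B₀) * #B) :=
      card_filter_product_le_add B B₀ fun p => ¬ E v p.1 p.2
    have e2 : ¬ m ^ 2 < 1000 * missCard E B₀ B₀ v := fun hlt => hvZ (mem_filter.2 ⟨hv, hlt⟩)
    omega
  · intro v hv
    have e1 : linkCard E B₀ B₀ v ≤ linkCard E B B v + 2 * (#(B₀ \ B) * #B₀) :=
      card_filter_product_le_add B₀ B fun p => E v p.1 p.2
    have e2 := mem_compl.1 (mem_filter.1 hv).1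
    rw [hBmem] at e2
    omega
  · intro v hv
    have e1 := missCard_compl_le hE hcod B v
    have e2 := (hlink v hv).2
    have e3 : 1000000 * (#Bᶜ - 2 * m) ≤ m := by omega
    have e4 := Nat.mul_le_mul (show #B ≤ 4 * m by omega) e3
    have e5 : 10000000000 * m ≤ m * m := Nat.mul_le_mul_right _ hm
    have e6 : #Bᶜ ≤ 5 * m := by omega
    have e7 : m ^ 2 / 100 * 100 ≤ m ^ 2 := Nat.div_mul_le_self _ _
    nlinarith

end Stability

/-! ### Translation between hypergraphs and triple systems -/

namespace Hypergraph

variable {V : Type*} (H : Hypergraph V)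

/-- The edges of `H` as ordered triples of vertices. -/
def TripleRel (x y z : H.vertexSet) : Prop := ({(x : V), (y : V), (z : V)} : Set V) ∈ H.edgeSet

variable {H}

theorem isTripleSystem_tripleRel (hH : H.IsUniform 3) : IsTripleSystem H.TripleRel where
  swap {x y z} h := by
    rwa [TripleRel, Set.insert_comm]
  rot {x y z} h := by
    rwa [TripleRel, Set.pair_comm]
  ne {x y z} h hxy := by
    have h1 := hH _ h
    rw [hxy, Set.insert_eq_of_mem (Set.mem_insert _ _)] at h1
    have := Set.ncard_insert_le (y : V) {(z : V)}
    rw [Set.ncard_singleton] at this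
    omega

theorem minCodegree_le_card_tripleRel (hH : H.IsUniform 3) [Fintype H.vertexSet]
    [∀ x y, DecidablePred (H.TripleRel x y)] {x y : H.vertexSet} (hxy : x ≠ y) :
    H.minCodegree 3 ≤ #{z | H.TripleRel x y z} := by
  have hxy' : (x : V) ≠ y := fun h => hxy (Subtype.ext h)
  have h1 : H.minCodegree 3 ≤ H.degree {(x : V), (y : V)} := by
    refine Nat.sInf_le ⟨_, ?_, ?_, rfl⟩
    · rintro v (rfl | rfl)
      exacts [x.2, y.2]
    · rw [Set.ncard_pair hxy']
  refine h1.trans ?_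
  have hsub : {e | e ∈ H.edgeSet ∧ ({(x : V), (y : V)} : Set V) ⊆ e} ⊆
      (fun z : H.vertexSet => ({(x : V), (y : V), (z : V)} : Set V)) ''
        ↑({z | H.TripleRel x y z} : Finset H.vertexSet) := by
    rintro e ⟨he, hxye⟩
    have hz : (e \ {(x : V), (y : V)}).ncard = 1 := by
      rw [Set.ncard_sdiff hxye (Set.toFinite _), hH e he, Set.ncard_pair hxy']
    obtain ⟨z, hz⟩ := Set.ncard_eq_one.1 hz
    have hze : z ∈ e := Set.sdiff_subset (hz ▸ Set.mem_singleton z)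
    have hez : e = {(x : V), (y : V), z} := by
      rw [← Set.union_sdiff_cancel hxye, hz, Set.insert_union, Set.singleton_union]
    refine ⟨⟨z, H.subset_vertexSet_of_mem_edgeSet' he hze⟩, ?_, hez.symm⟩
    rw [coe_filter]
    refine ⟨mem_univ _, ?_⟩
    rw [TripleRel, ← hez]
    exact he
  refine (Set.ncard_le_ncard hsub (Set.toFinite _)).trans ((Set.ncard_image_le (Set.toFinite _)).trans ?_)
  rw [Set.ncard_coe_finset]

/-- Each edge is counted once per ordering of its vertices; the crude bound 3³ on these orderings
suffices. -/
theorem sum_linkCard_le (hH : H.IsUniform 3) [Fintype H.vertexSet] {S : Set V}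
    {B : Finset H.vertexSet} (hBS : ∀ x ∈ B, (x : V) ∈ S) :
    ∑ b ∈ B, linkCard H.TripleRel B B b ≤ 27 * (H.induce S).edgeSet.ncard := by
  classical
  have hfin : (H.induce S).edgeSet.Finite := by
    refine Set.Finite.subset (Set.toFinite H.vertexSet).finite_subsets fun e he => ?_
    exact H.subset_vertexSet_of_mem_edgeSet' he.1
  simp only [linkCard]
  rw [← card_filter_product_eq_sum B (B ×ˢ B) fun b p => H.TripleRel b p.1 p.2,
    Set.ncard_eq_toFinset_card _ hfin]
  refine card_le_mul_card_image_of_maps_to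
    (f := fun q => ({(q.1 : V), (q.2.1 : V), (q.2.2 : V)} : Set V)) ?_ 27 ?_
  · intro q hq
    simp only [mem_filter, mem_product] at hq
    rw [Set.Finite.mem_toFinset]
    refine ⟨hq.2, ?_⟩
    rintro v (rfl | rfl | rfl)
    exacts [hBS _ hq.1.1, hBS _ hq.1.2.1, hBS _ hq.1.2.2]
  · intro e he
    rw [Set.Finite.mem_toFinset] at he
    let F : Finset H.vertexSet := {x | (x : V) ∈ e}
    have hF : #F ≤ 3 := by
      rw [← hH e he.1, ← card_image_of_injective F Subtype.val_injective, ← Set.ncard_coe_finset]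
      refine Set.ncard_le_ncard ?_
        ((Set.toFinite H.vertexSet).subset (H.subset_vertexSet_of_mem_edgeSet' he.1))
      intro v hv
      simp only [coe_image, Set.mem_image, mem_coe, F, mem_filter] at hv
      obtain ⟨x, hx, rfl⟩ := hv
      exact hx.2
    have hsub : #(F ×ˢ (F ×ˢ F)) ≤ 27 := by
      rw [card_product, card_product]
      exact Nat.mul_le_mul hF (Nat.mul_le_mul hF hF)
    refine (card_le_card fun q hq => ?_).trans hsub
    have := (mem_filter.1 hq).2
    simp only [mem_product, F, mem_filter, mem_univ, true_and, ← this]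
    simp

/-- The last clause, that tiles stay inside `S`, strengthens the induction: it makes a new tile
disjoint from the earlier ones. -/
theorem exists_isTiling_of_tileable {S : Finset H.vertexSet} (hS : Tileable H.TripleRel S) :
    ∃ 𝓕 : Set (Hypergraph V), IsTiling generalisedTriangle H 𝓕 ∧
      (∀ x ∈ S, ∃ K ∈ 𝓕, (x : V) ∈ K.vertexSet) ∧
      ∀ K ∈ 𝓕, ∀ v ∈ K.vertexSet, ∃ x ∈ S, (x : V) = v := by
  classical
  induction hS with
  | empty => exact ⟨∅, ⟨by simp, by simp⟩, by simp, by simp⟩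
  | @add S a b c d e hS hn hd h1 h2 h3 ih =>
    obtain ⟨𝓕, ⟨hcopy, hdisj⟩, hcov, hin⟩ := ih
    let φ : Fin 5 → H.vertexSet := ![a, b, c, d, e]
    have hφ : Function.Injective φ := by
      have hget : φ = [a, b, c, d, e].get := by funext i; fin_cases i <;> rfl
      rw [hget]
      exact List.nodup_iff_injective_get.1 hn
    let K : Hypergraph V := generalisedTriangle.image fun i => (φ i : V)
    have hKmem : ∀ v, v ∈ K.vertexSet ↔
        ∃ x ∈ [a, b, c, d, e], (x : V) = v := by
      intro v
      simp only [K, Hypergraph.image, generalisedTriangle, Set.image_univ, Set.mem_range]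
      simp [Fin.exists_fin_succ, φ]
    have hKdisj : ∀ L ∈ 𝓕, Disjoint K.vertexSet L.vertexSet := by
      intro L hL
      rw [Set.disjoint_left]
      intro v hv hv'
      obtain ⟨x, hx, rfl⟩ := (hKmem v).1 hv
      obtain ⟨y, hy, hyx⟩ := hin L hL _ hv'
      rw [Subtype.ext hyx] at hy
      exact hd x hx hy
    refine ⟨insert K 𝓕, ⟨?_, ?_⟩, ?_, ?_⟩
    · rintro L (rfl | hL)
      · refine ⟨⟨?_, ?_⟩, fun i => (φ i : V), ?_, rfl⟩
        · intro v hv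
          obtain ⟨x, -, rfl⟩ := (hKmem v).1 hv
          exact x.2
        · intro f hf
          simp only [K, Hypergraph.image, generalisedTriangle, Set.mem_image, Set.mem_insert_iff,
            Set.mem_singleton_iff] at hf
          obtain ⟨g, rfl | rfl | rfl, rfl⟩ := hf
          · simpa [Set.image_insert_eq, φ, TripleRel] using h1
          · simpa [Set.image_insert_eq, φ, TripleRel] using h2
          · simpa [Set.image_insert_eq, φ, TripleRel] using h3
        · exact (Subtype.val_injective.comp hφ).injOn
      · exact hcopy L hL
    · refine hdisj.insert fun L hL _ => ⟨hKdisj L hL, (hKdisj L hL).symm⟩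
    · intro x hx
      have hx' : x ∈ S ∨ x ∈ [a, b, c, d, e] := by
        simp only [mem_union, mem_insert, mem_singleton] at hx
        simpa using hx
      rcases hx' with hx | hx
      · obtain ⟨L, hL, hxL⟩ := hcov x hx
        exact ⟨L, Set.mem_insert_of_mem _ hL, hxL⟩
      · exact ⟨K, Set.mem_insert _ _, (hKmem _).2 ⟨x, hx, rfl⟩⟩
    · rintro L (rfl | hL) v hv
      · obtain ⟨x, hx, hxv⟩ := (hKmem v).1 hv
        exact ⟨x, by simp at hx ⊢; tauto, hxv⟩
      · obtain ⟨x, hx, hxv⟩ := hin L hL v hv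
        exact ⟨x, by simp [hx], hxv⟩

end Hypergraph

theorem lemma1p3 :
    ∃ γ : ℝ, 0 < γ ∧ ∃ n₀ : ℕ, ∀ (V : Type*) (H : Hypergraph V) (n : ℕ),
      H.IsUniform 3 → H.vertexSet.Finite → H.vertexSet.ncard = n → n₀ ≤ n → 5 ∣ n →
      2 * (n : ℝ) / 5 ≤ (H.minCodegree 3 : ℝ) →
      H.IsExtremal γ →
      ∃ 𝓕 : Set (Hypergraph V), Hypergraph.IsPerfectTiling Hypergraph.generalisedTriangle H 𝓕 := by
  classical
  -- With at most 27m³ triples in `S` and at most 27 orderings per edge, the link sum is at most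
  -- 729m³/10¹² ≤ m³/10⁹. The bound on n gives m ≥ 10¹⁰.
  refine ⟨1 / 1000000000000, by norm_num, 50000000000, ?_⟩
  rintro V H n hH hfin hn hn₀ ⟨m, rfl⟩ hdeg ⟨S, hSV, hScard, hSd⟩
  have hm : 10000000000 ≤ m := by omega
  have : Fintype H.vertexSet := hfin.fintype
  have hcod : 2 * m ≤ H.minCodegree 3 := by
    have : ((2 * m : ℕ) : ℝ) ≤ (H.minCodegree 3 : ℝ) := by
      push_cast at hdeg ⊢
      linarith
    exact_mod_cast this
  have hS3 : S.ncard = 3 * m := by rw [hScard, hn]; omega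
  have hedges : 1000000000000 * (H.induce S).edgeSet.ncard ≤ 27 * m ^ 3 := by
    have hvs : (H.induce S).vertexSet = S := rfl
    rw [Hypergraph.density, hvs, hS3, div_le_iff₀
      (by exact_mod_cast Nat.choose_pos (by omega))] at hSd
    have e1 : (((3 * m).choose 3 : ℕ) : ℝ) ≤ (((3 * m) ^ 3 : ℕ) : ℝ) :=
      Nat.cast_le.2 (Nat.choose_le_pow _ _)
    push_cast at e1
    have : ((1000000000000 * (H.induce S).edgeSet.ncard : ℕ) : ℝ) ≤ ((27 * m ^ 3 : ℕ) : ℝ) := by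
      push_cast
      nlinarith
    exact_mod_cast this
  have hlink := Hypergraph.sum_linkCard_le hH (S := S)
    (B := {x : H.vertexSet | (x : V) ∈ S}) (fun x hx => (mem_filter.1 hx).2)
  have hB : #{x : H.vertexSet | (x : V) ∈ S} = 3 * m := by
    rw [← hS3, ← card_image_of_injective _ Subtype.val_injective, ← Set.ncard_coe_finset]
    congr 1
    ext v
    simp only [coe_image, Set.mem_image, mem_coe, mem_filter, mem_univ, true_and]
    exact ⟨fun ⟨x, hx, hxv⟩ => hxv ▸ hx, fun hv => ⟨⟨v, hSV hv⟩, hv, rfl⟩⟩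
  have htile : Tileable H.TripleRel univ := by
    refine tileable_univ_of_sparse (m := m) (Hypergraph.isTripleSystem_tripleRel hH)
      (fun x y hxy => ?_) ?_ hm (B₀ := {x : H.vertexSet | (x : V) ∈ S}) ?_ ?_
    · refine (hcod.trans (Hypergraph.minCodegree_le_card_tripleRel hH hxy)).trans_eq ?_
      congr
    · rw [← hn, ← Nat.card_eq_fintype_card, Nat.card_coe_set_eq]
    · exact hB
    · omega
  obtain ⟨𝓕, h𝓕, hcov, -⟩ := Hypergraph.exists_isTiling_of_tileable htile
  exact ⟨𝓕, h𝓕, fun v hv => hcov ⟨v, hv⟩ (mem_univ _)⟩
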